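/- **Setting.** Let $m,n\ge 0$ and let $G$ be a Clifford unitary on $m+n$ qubits, the last $n$ of which are ancillas. Write $\mathcal P^m=\{I,X,Y,Z\}^m$, let $\langle P,Q\rangle\in\mathbb Z_2$ be $0$ if the Pauli operators $P,Q$ commute and $1$ otherwise, let $pt(P)$ be the bit string marking the qubits on which $P$ acts as a non-identity, and $\mathcal G^\dagger(P)=G^\dagger PG$ (a Pauli operator up to sign). A noisy mid-circuit measurement (MCM) with outcomes $k\in\mathbb Z_2^n$ is $\mathcal T_k(\sigma)=\mathcal U_k(G\sigma G^\dagger)$ with $$\mathcal U_k(\sigma)=\sum_{a,b\in\mathbb Z_2^n,\,P\in\mathcal P^m}p_{a,b}^P\,(P\otimes|k+b\rangle\langle k+a|)\,\sigma\,(P\otimes|k+a\rangle\langle k+b|),$$ where $p$ is a probability distribution; its Pauli fidelities are $\lambda^Q_{x,y}=\sum_{a,b,P}(-1)^{a\cdot x+b\cdot y+\langle P,Q\rangle}p^P_{a,b}$. A *noise model* $\mathcal N$ (for $G$ and a fixed family of multi-qubit Clifford gates $G_i$) consists of an initial state $\rho$, a Pauli noise channel acting after each gate $G_i$, error rates $p$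 of the MCM, and a Pauli noise channel $\Lambda_M$ acting before the terminating measurement, whose Pauli fidelities depend only on weight patterns. All error rates and all Pauli fidelities are strictly positive, and $\rho$ has, for all $Q\in\mathcal P^m$, $x\in\mathbb Z_2^n$, a nonzero expectation $\mathrm{Tr}(P\rho)\neq0$ for some Pauli operator $P$ with $pt(P)=pt(\mathcal G^\dagger(Q\otimes Z^x))$. An *experiment* prepares $\rho$, applies a finite sequence of noiseless single-qubit gates, noisy gates $G_i$ and noisy MCMs, and ends with an arbitrary POVM preceded by $\Lambda_M$. Two noise models are *indistinguishable* if every experiment yields the same distribution of all outcomes under both; a real function $f$ of noise models is *learnable* if $f(\mathcal N_1)=f(\mathcal N_2)$ whenever $\mathcal N_1,\mathcal N_2$ are indistinguishable. The *pattern transfer graph* is the directed multigraph with vertex set $\mathbb Z_2^{m+n}$ and one edge $e^Q_{x,y}$ from $pt(\mathcal G^\dagger(Q\otimes Z^x))$ to $pt(Q\otimes Z^y)$ for each $x,y\in\mathbb Z_2^n$, $Q\in\mathcal P^m$. A $1$-chain $\sum\epsilon^Q_{x,y}e^Q_{x,y}$ with real coefficients is a *cycle* if its boundary is $0$ (the boundary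 of an edge from $u$ to $v$ being the formal difference $v-u$), and it is identified with the function $\mathcal N\mapsto\sum\epsilon^Q_{x,y}\log\lambda^Q_{x,y}$. **Lemma.** For all $x_1,x_2,y_1,y_2\in\mathbb Z_2^n$ and $Q\in\mathcal P^m$: 1. The $1$-chain $e^Q_{x_1,y_1}+e^Q_{x_2,y_2}-e^Q_{x_2,y_1}-e^Q_{x_1,y_2}$ is a cycle. The function it represents, the correlation $$c^Q_{x_1,x_2,y_1,y_2}=\log\lambda^Q_{x_1,y_1}+\log\lambda^Q_{x_2,y_2}-\log\lambda^Q_{x_2,y_1}-\log\lambda^Q_{x_1,y_2},$$ is learnable. Moreover, the test of the measure-and-prepare structure by means of these correlations is robust against state preparation and terminating measurement (SPAM) noise: 2. Suppose $\{\mathcal U_k\}$ is a measure-and-prepare instrument, that is, each $\mathcal U_k$ acts as the outcome-$k$ map of some uniform stochastic instrument (a family of the above form $\mathcal U_k$ with some error-rate distribution), after which the ancillas are discarded, fresh ancillas are prepared in $|0^n\rangle$, a Pauli channel (independent of $k$) acts on all $m+n$ qubits, and $X^k$ is applied to the ancillas. Then the fidelities factorize: there are real $\zeta^Q_x,\xi^Q_y$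 with $\lambda^Q_{x,y}=\zeta^Q_x\,\xi^Q_y$ for all $x,y,Q$. 3. The fidelities factorize in this way if and only if all correlations $c^Q_{x_1,x_2,y_1,y_2}$ vanish. 4. If $\mathcal N_1$ and $\mathcal N_2$ are indistinguishable, then the fidelities of $\mathcal N_1$ factorize if and only if those of $\mathcal N_2$ do. -/

import Mathlib

open scoped Matrix BigOperators ComplexOrder

namespace MCM

noncomputable section

/-! ### Bit strings, Pauli operators, Clifford gates -/

/-- Bit strings indexed by a set of qubits. They label the computational basis,
the measurement results, and the Pauli weight patterns. -/
abbrev Bits (κ : Type*) := κ → ZMod 2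

/-- Operators on the Hilbert space of the qubits `κ`, written in the computational basis. -/
abbrev Op (κ : Type*) := Matrix (Bits κ) (Bits κ) ℂ

/-- The sign `(-1)^b`. -/
def sgn (b : ZMod 2) : ℝ := (-1) ^ b.val

/-- Pauli operators on the qubits `κ` modulo phase, in symplectic form: on every qubit the pair
`(0,0)` is `I`, `(1,0)` is `X`, `(0,1)` is `Z` and `(1,1)` is `Y`.
Multiplication modulo phase is addition of the pairs. -/
abbrev Pauli (κ : Type*) := κ → ZMod 2 × ZMod 2

/-- The matrix `i^(uv) X^u Z^v` of the single-qubit Pauli operator `(u, v)`. -/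
def pauliOne (P : ZMod 2 × ZMod 2) : Matrix (ZMod 2) (ZMod 2) ℂ :=
  Matrix.of fun s t =>
    Complex.I ^ (P.1.val * P.2.val) * (if s = t + P.1 then ((sgn (P.2 * t) : ℝ) : ℂ) else 0)

section General

variable {κ : Type*} [Fintype κ] [DecidableEq κ]

/-- The tensor product of single-qubit operators. -/
def localOp (A : κ → Matrix (ZMod 2) (ZMod 2) ℂ) : Op κ :=
  Matrix.of fun s t => ∏ q, A q (s q) (t q)

/-- The matrix of a Pauli operator (Hermitian, with tensor factors among `I, X, Y, Z`). -/
def pauliMat (P : Pauli κ) : Op κ := localOp fun q => pauliOne (P q)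

/-- The symplectic form of two Pauli operators: `0` if they commute, `1` if they anticommute. -/
def pauliForm (P Q : Pauli κ) : ZMod 2 := ∑ q, ((P q).1 * (Q q).2 + (P q).2 * (Q q).1)

/-- The Pauli weight pattern: `0` on the qubits where `P` acts as the identity, `1` elsewhere. -/
def pt (P : Pauli κ) : Bits κ := fun q => if P q = 0 then 0 else 1

/-- A Clifford unitary: conjugation takes every Pauli operator to a Pauli operator up to sign
(conjugation by `U` and by its adjoint give the same condition, as there are finitely many
Pauli operators). -/
def IsClifford (U : Op κ) : Prop :=
  U ∈ Matrix.unitaryGroup (Bits κ) ℂ ∧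
    ∀ P : Pauli κ, ∃ P' : Pauli κ,
      Uᴴ * pauliMat P * U = pauliMat P' ∨ Uᴴ * pauliMat P * U = -pauliMat P'

/-- The unitary channel `σ ↦ U σ U†`. -/
def conjBy (U σ : Op κ) : Op κ := U * σ * Uᴴ

/-- The channel with error rates `p`, which applies the Pauli operator `P` with
probability `p P`. -/
def pauliChannel (p : Pauli κ → ℝ) (σ : Op κ) : Op κ :=
  ∑ P, (p P : ℂ) • (pauliMat P * σ * pauliMat P)

/-- The Pauli fidelities of the Pauli channel with error rates `p`. -/
def pauliFidelity (p : Pauli κ → ℝ) (Q : Pauli κ) : ℝ := ∑ P, sgn (pauliForm P Q) * p P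

end General

/-- A Clifford gate on the qubits `κ`. -/
structure CliffordGate (κ : Type*) [Fintype κ] [DecidableEq κ] where
  mat : Op κ
  isClifford : IsClifford mat

/-- The Pauli operator `𝒢†(P) = G† P G`, modulo sign. -/
def CliffordGate.pull {κ : Type*} [Fintype κ] [DecidableEq κ] (G : CliffordGate κ)
    (P : Pauli κ) : Pauli κ := (G.isClifford.2 P).choose

/-- Pauli noise with strictly positive error rates (so that it is not on the boundary of the
completely positive polytope) and strictly positive Pauli fidelities. -/
structure PauliNoise (κ : Type*) [Fintype κ] [DecidableEq κ] where
  rate : Pauli κ → ℝ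
  rate_pos : ∀ P, 0 < rate P
  rate_sum : ∑ P, rate P = 1
  fidelity_pos : ∀ Q, 0 < pauliFidelity rate Q

/-! ### Mid-circuit measurements -/

/-- The qubits of a mid-circuit measurement: `m` unmeasured ones and `n` measured ancillas. -/
abbrev Qubits (m n : ℕ) := Fin m ⊕ Fin n

section Instrument

variable {m n : ℕ}

/-- The Pauli operator `Q ⊗ Z^x`. -/
def withZ (Q : Pauli (Fin m)) (x : Bits (Fin n)) : Pauli (Qubits m n) :=
  Sum.elim Q fun i => (0, x i)

/-- The operator `A ⊗ |k'⟩⟨k|`. -/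
def tensorKetBra (A : Op (Fin m)) (k' k : Bits (Fin n)) : Op (Qubits m n) :=
  Matrix.of fun s t =>
    A (s ∘ Sum.inl) (t ∘ Sum.inl) * (if s ∘ Sum.inr = k' ∧ t ∘ Sum.inr = k then 1 else 0)

/-- The map `𝒰_k` of the uniform stochastic instrument with error rates `p`:
`σ ↦ ∑ p_{a,b}^P (P ⊗ |k+b⟩⟨k+a|) σ (P ⊗ |k+a⟩⟨k+b|)`. -/
def instrument (p : Bits (Fin n) → Bits (Fin n) → Pauli (Fin m) → ℝ) (k : Bits (Fin n))
    (σ : Op (Qubits m n)) : Op (Qubits m n) :=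
  ∑ a, ∑ b, ∑ P, (p a b P : ℂ) •
    (tensorKetBra (pauliMat P) (k + b) (k + a) * σ * tensorKetBra (pauliMat P) (k + a) (k + b))

/-- The Pauli fidelities `λ_{x,y}^Q` of the uniform stochastic instrument with error rates `p`. -/
def instrumentFidelity (p : Bits (Fin n) → Bits (Fin n) → Pauli (Fin m) → ℝ)
    (x y : Bits (Fin n)) (Q : Pauli (Fin m)) : ℝ :=
  ∑ a, ∑ b, ∑ P, sgn (a ⬝ᵥ x + b ⬝ᵥ y + pauliForm P Q) * p a b P

/-- The partial trace over the ancillas. -/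
def traceAncilla (σ : Op (Qubits m n)) : Op (Fin m) :=
  Matrix.of fun s t => ∑ k : Bits (Fin n), σ (Sum.elim s k) (Sum.elim t k)

/-- The operator `I ⊗ X^k`. -/
def ancillaX (k : Bits (Fin n)) : Op (Qubits m n) :=
  pauliMat (Sum.elim (fun _ => 0) fun i => (k i, 0))

/-- The uniform stochastic instrument with error rates `p` is a measure-and-prepare instrument:
on outcome `k` it acts as some noisy measurement (a uniform stochastic instrument, with error
rates `u`), after which the ancillas are discarded, fresh ancillas are prepared in the state
`|0^n⟩`, Pauli noise (with error rates `e`) acts on all the qubits, and the correction `X^k` is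
applied to the ancillas. -/
def IsMeasureAndPrepare (p : Bits (Fin n) → Bits (Fin n) → Pauli (Fin m) → ℝ) : Prop :=
  ∃ (u : Bits (Fin n) → Bits (Fin n) → Pauli (Fin m) → ℝ) (e : Pauli (Qubits m n) → ℝ),
    (∀ a b P, 0 ≤ u a b P) ∧ ∑ a, ∑ b, ∑ P, u a b P = 1 ∧
    (∀ P, 0 ≤ e P) ∧ ∑ P, e P = 1 ∧
    ∀ (k : Bits (Fin n)) (σ : Op (Qubits m n)),
      instrument p k σ =
        conjBy (ancillaX k)
          (pauliChannel e (tensorKetBra (traceAncilla (instrument u k σ)) 0 0))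

end Instrument

/-- Noise of a mid-circuit measurement: a uniform stochastic instrument whose error rates and
Pauli fidelities are strictly positive. -/
structure MCMNoise (m n : ℕ) where
  rate : Bits (Fin n) → Bits (Fin n) → Pauli (Fin m) → ℝ
  rate_pos : ∀ a b P, 0 < rate a b P
  rate_sum : ∑ a, ∑ b, ∑ P, rate a b P = 1
  fidelity_pos : ∀ x y Q, 0 < instrumentFidelity rate x y Q

/-! ### Noise models, experiments, learnability -/

/-- A noise model for the mid-circuit measurement with Clifford gate `G`, in the presence of the
multi-qubit Clifford gates `gates i`: an unknown state, unknown Pauli noise after each gate, an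
unknown uniform stochastic instrument, and unknown symmetric Pauli noise before the terminating
measurement. Single-qubit gates are noiseless. The state overlaps with every weight pattern on
which the mid-circuit measurement is probed, as the state `|0…0⟩` does. -/
structure NoiseModel {m n : ℕ} {ι : Type*} (G : CliffordGate (Qubits m n))
    (gates : ι → CliffordGate (Qubits m n)) where
  state : Op (Qubits m n)
  state_posSemidef : state.PosSemidef
  state_trace : state.trace = 1
  state_overlap : ∀ (x : Bits (Fin n)) (Q : Pauli (Fin m)),
    ∃ P : Pauli (Qubits m n), pt P = pt (G.pull (withZ Q x)) ∧ (pauliMat P * state).trace ≠ 0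
  gateNoise : ι → PauliNoise (Qubits m n)
  mcm : MCMNoise m n
  measNoise : PauliNoise (Qubits m n)
  measNoise_symm : ∀ P Q, pt P = pt Q →
    pauliFidelity measNoise.rate P = pauliFidelity measNoise.rate Q

/-- The steps of an experiment: a layer of arbitrary single-qubit gates, one of the multi-qubit
Clifford gates, or the mid-circuit measurement. -/
inductive Step (m n : ℕ) (ι : Type*) where
  | single (U : Qubits m n → Matrix.unitaryGroup (ZMod 2) ℂ)
  | gate (i : ι)
  | mcm

/-- A POVM with `d` outcomes. -/
structure POVM (κ : Type*) [Fintype κ] [DecidableEq κ] (d : ℕ) where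
  effect : Fin d → Op κ
  posSemidef : ∀ j, (effect j).PosSemidef
  sum_eq_one : ∑ j, effect j = 1

section Learnability

variable {m n : ℕ} {ι : Type*} {G : CliffordGate (Qubits m n)}
  {gates : ι → CliffordGate (Qubits m n)}

/-- The Pauli fidelity `λ_{x,y}^Q` of the mid-circuit measurement in the noise model. -/
def NoiseModel.fid (N : NoiseModel G gates) (x y : Bits (Fin n)) (Q : Pauli (Fin m)) : ℝ :=
  instrumentFidelity N.mcm.rate x y Q

/-- The unnormalized state after a list of steps in which the mid-circuit measurements returned,
in this order, the given list of results; it is `0` if the number of results is not the number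
of mid-circuit measurements. -/
def NoiseModel.run (N : NoiseModel G gates) :
    List (Step m n ι) → List (Bits (Fin n)) → Op (Qubits m n) → Op (Qubits m n)
  | [], [], σ => σ
  | [], _ :: _, _ => 0
  | .single U :: l, ks, σ =>
      N.run l ks (conjBy (localOp fun q => (U q : Matrix (ZMod 2) (ZMod 2) ℂ)) σ)
  | .gate i :: l, ks, σ =>
      N.run l ks (pauliChannel (N.gateNoise i).rate (conjBy (gates i).mat σ))
  | .mcm :: _, [], _ => 0
  | .mcm :: l, k :: ks, σ => N.run l ks (instrument N.mcm.rate k (conjBy G.mat σ))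

/-- The probability that the experiment with the given steps and terminating measurement returns
the mid-circuit results `ks` and the terminating result `j`. -/
def NoiseModel.prob (N : NoiseModel G gates) (steps : List (Step m n ι)) {d : ℕ}
    (F : POVM (Qubits m n) d) (ks : List (Bits (Fin n))) (j : Fin d) : ℝ :=
  (F.effect j * pauliChannel N.measNoise.rate (N.run steps ks N.state)).trace.re

/-- Two noise models are indistinguishable if every experiment has the same outcome distribution
under both. -/
def Indistinguishable (N₁ N₂ : NoiseModel G gates) : Prop :=
  ∀ (steps : List (Step m n ι)) (d : ℕ) (F : POVM (Qubits m n) d)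
    (ks : List (Bits (Fin n))) (j : Fin d), N₁.prob steps F ks j = N₂.prob steps F ks j

/-- A function of the noise model is learnable if it agrees on indistinguishable noise models. -/
def Learnable (f : NoiseModel G gates → ℝ) : Prop :=
  ∀ N₁ N₂, Indistinguishable N₁ N₂ → f N₁ = f N₂

/-- The correlation `c^Q_{x₁,x₂,y₁,y₂}` of the log Pauli fidelities. -/
def NoiseModel.correlation (N : NoiseModel G gates) (x₁ x₂ y₁ y₂ : Bits (Fin n))
    (Q : Pauli (Fin m)) : ℝ :=
  Real.log (N.fid x₁ y₁ Q) + Real.log (N.fid x₂ y₂ Q)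
    - Real.log (N.fid x₂ y₁ Q) - Real.log (N.fid x₁ y₂ Q)

/-- The Pauli fidelities of the mid-circuit measurement factorize, `λ_{x,y}^Q = ζ_x^Q ξ_y^Q`. -/
def NoiseModel.FidelitiesFactorize (N : NoiseModel G gates) : Prop :=
  ∃ ζ ξ : Bits (Fin n) → Pauli (Fin m) → ℝ, ∀ x y Q, N.fid x y Q = ζ x Q * ξ y Q

end Learnability

/-! ### The pattern transfer graph

The vertices are the weight patterns in `Bits (Qubits m n)`. -/

/-- The edge `e_{x,y}^Q` of the pattern transfer graph (a multigraph: distinct labels are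
distinct edges). -/
structure Edge (m n : ℕ) where
  x : Bits (Fin n)
  y : Bits (Fin n)
  Q : Pauli (Fin m)

section Graph

variable {m n : ℕ} (G : CliffordGate (Qubits m n))

/-- The start point `pt(𝒢†(Q ⊗ Z^x))` of an edge. -/
def Edge.src (e : Edge m n) : Bits (Qubits m n) := pt (G.pull (withZ e.Q e.x))

/-- The end point `pt(Q ⊗ Z^y)` of an edge. -/
def Edge.tgt (e : Edge m n) : Bits (Qubits m n) := pt (withZ e.Q e.y)

/-- The boundary operator from `1`-chains to `0`-chains. -/
def boundary : (Edge m n →₀ ℝ) →ₗ[ℝ] (Bits (Qubits m n) →₀ ℝ) :=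
  Finsupp.linearCombination ℝ fun e : Edge m n =>
    Finsupp.single e.tgt (1 : ℝ) - Finsupp.single (e.src G) 1

/-- The cycle space: the `1`-chains with boundary `0`. -/
def cycleSpace : Submodule ℝ (Edge m n →₀ ℝ) := LinearMap.ker (boundary G)

/-- A `1`-chain `∑ ε_e e` as a function `N ↦ ∑ ε_e log λ_e` of the noise model. -/
def chainValue {G : CliffordGate (Qubits m n)} {ι : Type*}
    {gates : ι → CliffordGate (Qubits m n)} (μ : Edge m n →₀ ℝ) (N : NoiseModel G gates) : ℝ :=
  μ.sum fun e c => c * Real.log (N.fid e.x e.y e.Q)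

/-- The `1`-chain `e^Q_{x₁,y₁} + e^Q_{x₂,y₂} - e^Q_{x₂,y₁} - e^Q_{x₁,y₂}`. -/
def correlationChain (x₁ x₂ y₁ y₂ : Bits (Fin n)) (Q : Pauli (Fin m)) : Edge m n →₀ ℝ :=
  Finsupp.single ⟨x₁, y₁, Q⟩ 1 + Finsupp.single ⟨x₂, y₂, Q⟩ 1
    - Finsupp.single ⟨x₂, y₁, Q⟩ 1 - Finsupp.single ⟨x₁, y₂, Q⟩ 1

end Graph

end

end MCM

namespace MCM

/-! Weighting the outcomes `k` of one MCM by the sign $(-1)^{(x+y)\cdot k}$ turns the adjoint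
instrument into a map diagonal on Pauli operators: it sends $Q\otimes Z^y$ to
$\lambda^Q_{x,y}\,Q\otimes Z^x$ (`sum_sgn_trace_instrument`). A single-qubit layer, one MCM and a
Pauli measurement therefore reveal a product (preparation factor depending on $x$) ·
$\lambda^Q_{x,y}$ · (readout factor depending on $y$), by `exists_experiment`. For fixed $Q$, the
log fidelities of indistinguishable models thus differ by some $\alpha_x+\beta_y$
(`Indistinguishable.exists_gauge`), and the alternating sum over a rectangle cancels every such
term. This is learnability.

Factorization says that, for each $Q$, $\log\lambda^Q_{x,y}$ is itself a function of $x$ plus a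
function of $y$, which is the vanishing of all rectangle sums; it is therefore read off from
learnable quantities. For a measure-and-prepare instrument the trace over the ancillas separates the
measuring stage, which sees only $x$, from the preparing stage, which sees only $y$. -/

/-! ### Signs of bits. -/

theorem zmod_two_cases (u : ZMod 2) : u = 0 ∨ u = 1 := by
  revert u; decide

@[simp] theorem sgn_zero : sgn 0 = 1 := by simp [sgn]

@[simp] theorem sgn_one : sgn 1 = -1 := by simp [sgn, ZMod.val_one]

theorem sgn_add (a b : ZMod 2) : sgn (a + b) = sgn a * sgn b := by
  rcases zmod_two_cases a with rfl | rfl <;> rcases zmod_two_cases b with rfl | rfl <;>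
    simp [CharTwo.add_self_eq_zero]

theorem sgn_mul_self (a : ZMod 2) : sgn a * sgn a = 1 := by
  rcases zmod_two_cases a with rfl | rfl <;> simp

theorem sgn_sum {κ : Type*} (s : Finset κ) (f : κ → ZMod 2) :
    sgn (∑ i ∈ s, f i) = ∏ i ∈ s, sgn (f i) := by
  classical
  induction s using Finset.induction_on with
  | empty => simp
  | insert a s ha ih => rw [Finset.sum_insert ha, Finset.prod_insert ha, sgn_add, ih]

/-! ### Single-qubit Pauli operators -/

theorem pauliOne_mul_self (P : ZMod 2 × ZMod 2) : pauliOne P * pauliOne P = 1 := by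
  obtain ⟨a, b⟩ := P
  ext s t
  rcases zmod_two_cases a with rfl | rfl <;> rcases zmod_two_cases b with rfl | rfl <;>
  rcases zmod_two_cases s with rfl | rfl <;> rcases zmod_two_cases t with rfl | rfl <;>
    simp [pauliOne, Matrix.mul_apply, CharTwo.add_self_eq_zero, ZMod.val_one]

theorem pauliOne_conjTranspose (P : ZMod 2 × ZMod 2) : (pauliOne P)ᴴ = pauliOne P := by
  obtain ⟨a, b⟩ := P
  ext s t
  rcases zmod_two_cases a with rfl | rfl <;> rcases zmod_two_cases b with rfl | rfl <;>
  rcases zmod_two_cases s with rfl | rfl <;> rcases zmod_two_cases t with rfl | rfl <;>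
    simp [pauliOne, CharTwo.add_self_eq_zero, ZMod.val_one]

theorem pauliOne_mul_comm (P Q : ZMod 2 × ZMod 2) :
    pauliOne P * pauliOne Q =
      ((sgn (P.1 * Q.2 + P.2 * Q.1) : ℝ) : ℂ) • (pauliOne Q * pauliOne P) := by
  obtain ⟨a, b⟩ := P
  obtain ⟨c, d⟩ := Q
  ext s t
  rcases zmod_two_cases a with rfl | rfl <;> rcases zmod_two_cases b with rfl | rfl <;>
  rcases zmod_two_cases c with rfl | rfl <;> rcases zmod_two_cases d with rfl | rfl <;>
  rcases zmod_two_cases s with rfl | rfl <;> rcases zmod_two_cases t with rfl | rfl <;>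
    simp [pauliOne, Matrix.mul_apply, CharTwo.add_self_eq_zero, ZMod.val_one]

theorem pauliOne_conj (P Q : ZMod 2 × ZMod 2) :
    pauliOne P * pauliOne Q * pauliOne P =
      ((sgn (P.1 * Q.2 + P.2 * Q.1) : ℝ) : ℂ) • pauliOne Q := by
  rw [pauliOne_mul_comm, Matrix.smul_mul, Matrix.mul_assoc, pauliOne_mul_self, Matrix.mul_one]

/-- Two Pauli operators that differ and are not the identity are swapped by the Hermitian unitary
`(P + R) / √2`. -/
theorem exists_unitary_conj_pauliOne {P R : ZMod 2 × ZMod 2} (h : P = 0 ↔ R = 0) :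
    ∃ U : Matrix.unitaryGroup (ZMod 2) ℂ,
      (U : Matrix (ZMod 2) (ZMod 2) ℂ)ᴴ * pauliOne R * (U : Matrix (ZMod 2) (ZMod 2) ℂ) =
        pauliOne P := by
  by_cases hPR : P = R
  · exact ⟨1, by simp [hPR]⟩
  -- `P` and `R` are distinct and both differ from the identity, so they anticommute.
  have hform : P.1 * R.2 + P.2 * R.1 = 1 := by
    revert P R
    decide
  have hanti : pauliOne P * pauliOne R = -(pauliOne R * pauliOne P) := by
    rw [pauliOne_mul_comm, hform]
    simp
  set A := pauliOne P
  set B := pauliOne R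
  have hA : A * A = 1 := pauliOne_mul_self P
  have hB : B * B = 1 := pauliOne_mul_self R
  have hs : ((Real.sqrt 2 : ℝ) : ℂ)⁻¹ * ((Real.sqrt 2 : ℝ) : ℂ)⁻¹ = 2⁻¹ := by
    rw [← mul_inv, ← Complex.ofReal_mul, Real.mul_self_sqrt (by norm_num)]
    norm_num
  set c : ℂ := ((Real.sqrt 2 : ℝ) : ℂ)⁻¹
  have hc : star c = c := by simp [c]
  have hstar : (c • (A + B))ᴴ = c • (A + B) := by
    rw [Matrix.conjTranspose_smul, hc, Matrix.conjTranspose_add, pauliOne_conjTranspose,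
      pauliOne_conjTranspose]
  have hsq : (A + B) * (A + B) = (2 : ℂ) • 1 := by
    rw [add_mul, mul_add, mul_add, hA, hB, hanti, two_smul]
    abel
  refine ⟨⟨c • (A + B), ?_⟩, ?_⟩
  · rw [Matrix.mem_unitaryGroup_iff, Matrix.star_eq_conjTranspose, hstar, smul_mul_smul_comm, hs,
      hsq, smul_smul]
    norm_num
  · change (c • (A + B))ᴴ * B * (c • (A + B)) = A
    have key : (A + B) * B * (A + B) = (2 : ℂ) • A := by
      have h1 : A * B * A = -B := by rw [hanti, neg_mul, mul_assoc, hA, mul_one]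
      rw [add_mul, mul_add, add_mul, add_mul, h1, hB, mul_assoc A B B, hB, mul_one,
        one_mul, one_mul]
      module
    rw [hstar, smul_mul_assoc, smul_mul_smul_comm, hs, key, smul_smul]
    norm_num

/-! ### Pauli operators -/

section General

variable {κ : Type*} [Fintype κ]

theorem localOp_conjTranspose (A : κ → Matrix (ZMod 2) (ZMod 2) ℂ) :
    (localOp A)ᴴ = localOp fun q => (A q)ᴴ := by
  ext s t
  simp [localOp]

theorem localOp_one : localOp (fun _ : κ => 1) = 1 := by
  ext s t
  simp only [localOp, Matrix.of_apply, Matrix.one_apply, Finset.prod_ite_zero, funext_iff]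
  simp

theorem localOp_smul (c : κ → ℂ) (A : κ → Matrix (ZMod 2) (ZMod 2) ℂ) :
    localOp (fun q => c q • A q) = (∏ q, c q) • localOp A := by
  ext s t
  simp [localOp, Finset.prod_mul_distrib]

theorem pauliMat_conjTranspose (P : Pauli κ) : (pauliMat P)ᴴ = pauliMat P := by
  simp only [pauliMat, localOp_conjTranspose, pauliOne_conjTranspose]

variable [DecidableEq κ]

theorem localOp_mul (A B : κ → Matrix (ZMod 2) (ZMod 2) ℂ) :
    localOp A * localOp B = localOp fun q => A q * B q := by
  ext s t
  simp only [localOp, Matrix.mul_apply, Matrix.of_apply]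
  -- Distributivity: choosing one intermediate bit per qubit is choosing an intermediate bit string.
  rw [Finset.prod_univ_sum, Fintype.piFinset_univ]
  simp only [Finset.prod_mul_distrib]

theorem pauliMat_mul_self (P : Pauli κ) : pauliMat P * pauliMat P = 1 := by
  simp only [pauliMat, localOp_mul, pauliOne_mul_self, localOp_one]

theorem pauliMat_conj (P Q : Pauli κ) :
    pauliMat P * pauliMat Q * pauliMat P = ((sgn (pauliForm P Q) : ℝ) : ℂ) • pauliMat Q := by
  simp only [pauliMat, localOp_mul, pauliOne_conj, localOp_smul, pauliForm, sgn_sum,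
    Complex.ofReal_prod]

/-- Cyclicity of the trace moves a gate from the state to the observable; all later computations
take place in this Heisenberg picture. -/
theorem trace_mul_conjBy (A U σ : Op κ) : (A * conjBy U σ).trace = (Uᴴ * A * U * σ).trace := by
  rw [conjBy, ← Matrix.mul_assoc, Matrix.trace_mul_comm]
  simp only [Matrix.mul_assoc]

/-- Pauli operators are eigenvectors of the adjoint channel, since conjugation by a Pauli operator
only changes their sign. -/
theorem trace_pauliMat_mul_pauliChannel (p : Pauli κ → ℝ) (Q : Pauli κ) (σ : Op κ) :
    (pauliMat Q * pauliChannel p σ).trace = pauliFidelity p Q * (pauliMat Q * σ).trace := by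
  rw [pauliChannel, Matrix.mul_sum, Matrix.trace_sum, pauliFidelity, Complex.ofReal_sum,
    Finset.sum_mul]
  refine Finset.sum_congr rfl fun P _ => ?_
  have h := trace_mul_conjBy (pauliMat Q) (pauliMat P) σ
  rw [conjBy, pauliMat_conjTranspose, pauliMat_conj] at h
  rw [Matrix.mul_smul, Matrix.trace_smul, h, Matrix.smul_mul, Matrix.trace_smul]
  simp only [smul_eq_mul, Complex.ofReal_mul]
  ring

/-- Pauli operators of equal weight pattern are related by a layer of single-qubit gates. -/
theorem exists_single_conj_pauliMat {P R : Pauli κ} (h : pt P = pt R) :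
    ∃ U : κ → Matrix.unitaryGroup (ZMod 2) ℂ,
      (localOp fun q => (U q : Matrix (ZMod 2) (ZMod 2) ℂ))ᴴ * pauliMat R *
        (localOp fun q => (U q : Matrix (ZMod 2) (ZMod 2) ℂ)) = pauliMat P := by
  have hq : ∀ q, P q = 0 ↔ R q = 0 := fun q => by
    have := congrFun h q
    simp only [pt] at this
    split_ifs at this with h1 h2 h2 <;> simp_all
  choose U hU using fun q => exists_unitary_conj_pauliOne (hq q)
  refine ⟨U, ?_⟩
  simp only [pauliMat, localOp_conjTranspose, localOp_mul, hU]

/-- The expectation of a Pauli operator in a Hermitian operator is real. -/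
theorem trace_pauliMat_mul_im {P : Pauli κ} {σ : Op κ} (hσ : σ.IsHermitian) :
    (pauliMat P * σ).trace.im = 0 := by
  rw [← Complex.conj_eq_iff_im, starRingEnd_apply, ← Matrix.trace_conjTranspose,
    Matrix.conjTranspose_mul, pauliMat_conjTranspose, hσ.eq, Matrix.trace_mul_comm]

/-- The measurement of a Pauli operator. -/
noncomputable def pauliPOVM (P : Pauli κ) : POVM κ 2 where
  effect j := (2⁻¹ : ℂ) • (1 + (-1 : ℂ) ^ (j : ℕ) • pauliMat P)
  posSemidef j := by
    set E : Op κ := (2⁻¹ : ℂ) • (1 + (-1 : ℂ) ^ (j : ℕ) • pauliMat P) with hE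
    have hH : Eᴴ = E := by
      rw [hE, Matrix.conjTranspose_smul, Matrix.conjTranspose_add, Matrix.conjTranspose_smul,
        pauliMat_conjTranspose]
      simp
    have hsq : E * E = E := by
      rw [hE, smul_mul_smul_comm, add_mul, mul_add, mul_add, smul_mul_smul_comm,
        pauliMat_mul_self, ← mul_pow]
      simp only [mul_one, one_mul, neg_mul_neg, one_pow, one_smul]
      module
    -- The effect is a Hermitian projection, so it equals $E^\dagger E$.
    rw [← hsq]
    nth_rewrite 1 [← hH]
    exact Matrix.posSemidef_conjTranspose_mul_self E
  sum_eq_one := by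
    rw [Fin.sum_univ_two]
    simp only [Fin.val_zero, Fin.val_one, pow_zero, pow_one]
    module

theorem pauliPOVM_effect_sub (P : Pauli κ) :
    (pauliPOVM P).effect 0 - (pauliPOVM P).effect 1 = pauliMat P := by
  simp only [pauliPOVM, Fin.val_zero, Fin.val_one, pow_zero, pow_one]
  module

end General

/-! ### Uniform stochastic instruments -/

section Instrument

variable {m n : ℕ}

theorem sum_bits_qubits {M : Type*} [AddCommMonoid M] (f : Bits (Qubits m n) → M) :
    ∑ s, f s = ∑ u : Bits (Fin m), ∑ k : Bits (Fin n), f (Sum.elim u k) := by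
  rw [← (Equiv.sumArrowEquivProdArrow (Fin m) (Fin n) (ZMod 2)).symm.sum_comp,
    Fintype.sum_prod_type]
  rfl

theorem tensorKetBra_sumElim (A : Op (Fin m)) (k' k l l' : Bits (Fin n)) (s t : Bits (Fin m)) :
    tensorKetBra A k' k (Sum.elim s l) (Sum.elim t l') =
      if l = k' then if l' = k then A s t else 0 else 0 := by
  by_cases hl : l = k' <;> by_cases hl' : l' = k <;> simp [tensorKetBra, hl, hl']

theorem tensorKetBra_mul (A B : Op (Fin m)) (k₁ k₂ k₃ : Bits (Fin n)) :
    tensorKetBra A k₁ k₂ * tensorKetBra B k₂ k₃ = tensorKetBra (A * B) k₁ k₃ := by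
  ext s t
  rw [Matrix.mul_apply, sum_bits_qubits]
  simp only [tensorKetBra, Matrix.of_apply, Sum.elim_comp_inl, Sum.elim_comp_inr, Matrix.mul_apply, Finset.sum_mul]
  refine Finset.sum_congr rfl fun u _ => ?_
  rw [Finset.sum_eq_single k₂ (by intros; simp_all) (by simp)]
  split_ifs <;> simp_all

theorem tensorKetBra_mul_of_ne (A B : Op (Fin m)) {k₂ k₂' : Bits (Fin n)} (h : k₂ ≠ k₂')
    (k₁ k₃ : Bits (Fin n)) : tensorKetBra A k₁ k₂ * tensorKetBra B k₂' k₃ = 0 := by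
  ext s t
  rw [Matrix.mul_apply]
  refine Finset.sum_eq_zero fun u _ => ?_
  simp only [tensorKetBra, Matrix.of_apply]
  split_ifs <;> simp_all

theorem tensorKetBra_smul (c : ℂ) (A : Op (Fin m)) (k₁ k₂ : Bits (Fin n)) :
    tensorKetBra (c • A) k₁ k₂ = c • tensorKetBra A k₁ k₂ := by
  ext s t
  simp [tensorKetBra]

/-- Spectral decomposition of $Z^y$ in the computational basis of the ancillas. -/
theorem pauliMat_withZ (Q : Pauli (Fin m)) (y : Bits (Fin n)) :
    pauliMat (withZ Q y) =
      ∑ k, ((sgn (y ⬝ᵥ k) : ℝ) : ℂ) • tensorKetBra (pauliMat Q) k k := by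
  ext s t
  simp only [Matrix.sum_apply, Matrix.smul_apply, tensorKetBra, Matrix.of_apply, smul_eq_mul]
  rw [Finset.sum_eq_single (t ∘ Sum.inr) (fun k _ hk => by simp [hk.symm]) (by simp)]
  simp only [pauliMat, localOp, Matrix.of_apply, Fintype.prod_sum_type, withZ, Sum.elim_inl,
    Sum.elim_inr, Function.comp_apply, and_true, dotProduct, sgn_sum, Complex.ofReal_prod]
  rw [mul_left_comm]
  congr 1
  simp only [pauliOne, Matrix.of_apply, ZMod.val_zero, zero_mul, pow_zero, one_mul, add_zero,
    Finset.prod_ite_zero, funext_iff, Function.comp_apply, Finset.mem_univ, true_imp_iff]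
  split_ifs <;> simp

theorem tensorKetBra_conj_withZ (P Q : Pauli (Fin m)) (y k l : Bits (Fin n)) :
    tensorKetBra (pauliMat P) k l * pauliMat (withZ Q y) * tensorKetBra (pauliMat P) l k =
      ((sgn (y ⬝ᵥ l + pauliForm P Q) : ℝ) : ℂ) • tensorKetBra (pauliMat Q) k k := by
  rw [pauliMat_withZ, Matrix.mul_sum,
    Finset.sum_eq_single l (fun l' _ hl => by
      rw [Matrix.mul_smul, tensorKetBra_mul_of_ne _ _ hl.symm, smul_zero]) (by simp),
    Matrix.mul_smul, tensorKetBra_mul, Matrix.smul_mul, tensorKetBra_mul, pauliMat_conj,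
    tensorKetBra_smul, smul_smul, sgn_add, Complex.ofReal_mul]

/-- The Pauli fidelities are the eigenvalues of the signed sums of the maps of the instrument. -/
theorem sum_sgn_trace_instrument (p : Bits (Fin n) → Bits (Fin n) → Pauli (Fin m) → ℝ)
    (x y : Bits (Fin n)) (Q : Pauli (Fin m)) (σ : Op (Qubits m n)) :
    ∑ k, ((sgn ((x + y) ⬝ᵥ k) : ℝ) : ℂ) * (pauliMat (withZ Q y) * instrument p k σ).trace =
      instrumentFidelity p x y Q * (pauliMat (withZ Q x) * σ).trace := by
  have h1 : ∀ k a b P,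
      (pauliMat (withZ Q y) * (tensorKetBra (pauliMat P) (k + b) (k + a) * σ *
        tensorKetBra (pauliMat P) (k + a) (k + b))).trace =
      ((sgn (y ⬝ᵥ (k + b) + pauliForm P Q) : ℝ) : ℂ) *
        (tensorKetBra (pauliMat Q) (k + a) (k + a) * σ).trace := fun k a b P => by
    rw [← Matrix.mul_assoc, Matrix.trace_mul_comm, ← Matrix.mul_assoc, ← Matrix.mul_assoc,
      tensorKetBra_conj_withZ, Matrix.smul_mul, Matrix.trace_smul, smul_eq_mul]
  -- The sum over outcomes is reindexed by the shift `a`, so that its projectors match those of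
  -- `h1`.
  have h2 : ∀ a, (pauliMat (withZ Q x) * σ).trace =
      ∑ k, ((sgn (x ⬝ᵥ (k + a)) : ℝ) : ℂ) *
        (tensorKetBra (pauliMat Q) (k + a) (k + a) * σ).trace := fun a => by
    rw [pauliMat_withZ, Matrix.sum_mul, Matrix.trace_sum, ← Equiv.sum_comp (Equiv.addRight a)]
    simp [Matrix.trace_smul]
  simp only [instrument, Matrix.trace_sum, Matrix.mul_smul, Matrix.trace_smul, h1,
    Finset.mul_sum, instrumentFidelity, Complex.ofReal_sum, Finset.sum_mul, smul_eq_mul]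
  rw [Finset.sum_comm]
  refine Finset.sum_congr rfl fun a _ => ?_
  rw [Finset.sum_comm]
  refine Finset.sum_congr rfl fun b _ => ?_
  rw [Finset.sum_comm]
  refine Finset.sum_congr rfl fun P _ => ?_
  rw [h2 a, Finset.mul_sum]
  refine Finset.sum_congr rfl fun k _ => ?_
  have hy : ((sgn (y ⬝ᵥ k) : ℝ) : ℂ) * (sgn (y ⬝ᵥ k) : ℝ) = 1 := by
    rw [← Complex.ofReal_mul, sgn_mul_self, Complex.ofReal_one]
  have ha : ((sgn (x ⬝ᵥ a) : ℝ) : ℂ) * (sgn (x ⬝ᵥ a) : ℝ) = 1 := by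
    rw [← Complex.ofReal_mul, sgn_mul_self, Complex.ofReal_one]
  simp only [add_dotProduct, dotProduct_add, sgn_add, Complex.ofReal_mul, dotProduct_comm a x,
    dotProduct_comm b y]
  -- On the left the sign of $y\cdot k$ occurs twice, on the right that of $x\cdot a$; both squares
  -- are 1.
  linear_combination ((sgn (x ⬝ᵥ k) : ℝ) : ℂ) * (sgn (y ⬝ᵥ b) : ℝ) *
    (sgn (pauliForm P Q) : ℝ) * (p a b P : ℂ) *
    (tensorKetBra (pauliMat Q) (k + a) (k + a) * σ).trace * (hy - ha)

/-! ### Measure-and-prepare instruments -/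

/-- $Z^y$ acts as 1 on $|0^n\rangle$, so fresh ancillas erase the dependence on $y$. -/
theorem trace_withZ_mul_tensorKetBra (Q : Pauli (Fin m)) (y : Bits (Fin n)) (τ : Op (Fin m)) :
    (pauliMat (withZ Q y) * tensorKetBra τ 0 0).trace = (pauliMat Q * τ).trace := by
  rw [pauliMat_withZ, Matrix.sum_mul,
    Finset.sum_eq_single 0 (fun l _ hl => by
      rw [Matrix.smul_mul, tensorKetBra_mul_of_ne _ _ hl, smul_zero]) (by simp),
    Matrix.smul_mul, tensorKetBra_mul, dotProduct_zero, sgn_zero, Complex.ofReal_one, one_smul,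
    Matrix.trace, sum_bits_qubits]
  simp [tensorKetBra, Matrix.trace]

/-- The adjoint of discarding the ancillas is tensoring with their identity. -/
theorem trace_mul_traceAncilla (Q : Pauli (Fin m)) (σ : Op (Qubits m n)) :
    (pauliMat Q * traceAncilla σ).trace = (pauliMat (withZ Q 0) * σ).trace := by
  rw [pauliMat_withZ]
  simp only [zero_dotProduct, sgn_zero, Complex.ofReal_one, one_smul, Matrix.sum_mul,
    Matrix.trace_sum]
  simp only [Matrix.trace, Matrix.diag_apply, Matrix.mul_apply, traceAncilla, Matrix.of_apply,
    Finset.mul_sum, sum_bits_qubits, tensorKetBra_sumElim]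
  refine (Finset.sum_congr rfl fun s _ => Finset.sum_comm).trans
    (Finset.sum_comm.trans (Finset.sum_congr rfl fun k _ => Finset.sum_congr rfl fun s _ => ?_))
  rw [Finset.sum_eq_single k (fun l _ hl => by simp [hl]) (by simp)]
  simp

/-- This sign cancels the $y$ part of the weight $(-1)^{(x+y)\cdot k}$, leaving the weight that
defines the fidelity at $y=0$. -/
theorem ancillaX_conj_withZ (Q : Pauli (Fin m)) (y k : Bits (Fin n)) :
    (ancillaX k)ᴴ * pauliMat (withZ Q y) * ancillaX k =
      ((sgn (y ⬝ᵥ k) : ℝ) : ℂ) • pauliMat (withZ Q y) := by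
  rw [ancillaX, pauliMat_conjTranspose, pauliMat_conj]
  congr 3
  simp [pauliForm, withZ, dotProduct, Fintype.sum_sum_type, mul_comm]

theorem IsMeasureAndPrepare.exists_factorization
    {p : Bits (Fin n) → Bits (Fin n) → Pauli (Fin m) → ℝ} (hp : IsMeasureAndPrepare p) :
    ∃ ζ ξ : Bits (Fin n) → Pauli (Fin m) → ℝ,
      ∀ x y Q, instrumentFidelity p x y Q = ζ x Q * ξ y Q := by
  obtain ⟨u, e, -, -, -, -, h⟩ := hp
  refine ⟨fun x Q => instrumentFidelity u x 0 Q, fun y Q => pauliFidelity e (withZ Q y),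
    fun x y Q => ?_⟩
  -- The input $Q\otimes Z^x$ squares to the identity, whose trace is nonzero and can be cancelled
  -- at the end.
  have h1 := sum_sgn_trace_instrument p x y Q (pauliMat (withZ Q x))
  have h2 := sum_sgn_trace_instrument u x 0 Q (pauliMat (withZ Q x))
  have htr : (1 : Op (Qubits m n)).trace ≠ 0 := by
    rw [Matrix.trace_one, Nat.cast_ne_zero]
    exact Fintype.card_ne_zero
  simp only [h, trace_mul_conjBy, ancillaX_conj_withZ, Matrix.smul_mul, Matrix.trace_smul,
    trace_pauliMat_mul_pauliChannel, trace_withZ_mul_tensorKetBra, trace_mul_traceAncilla,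
    smul_eq_mul] at h1
  rw [pauliMat_mul_self] at h1 h2
  have h3 : (instrumentFidelity p x y Q : ℂ) * (1 : Op (Qubits m n)).trace =
      (instrumentFidelity u x 0 Q * pauliFidelity e (withZ Q y)) *
        (1 : Op (Qubits m n)).trace := by
    rw [← h1, mul_right_comm, ← h2, Finset.sum_mul]
    refine Finset.sum_congr rfl fun k _ => ?_
    have hy : ((sgn (y ⬝ᵥ k) : ℝ) : ℂ) * (sgn (y ⬝ᵥ k) : ℝ) = 1 := by
      rw [← Complex.ofReal_mul, sgn_mul_self, Complex.ofReal_one]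
    simp only [add_dotProduct, add_zero, sgn_add, Complex.ofReal_mul]
    linear_combination ((sgn (x ⬝ᵥ k) : ℝ) : ℂ) * (pauliFidelity e (withZ Q y) : ℂ) *
      (pauliMat (withZ Q 0) * instrument u k (pauliMat (withZ Q x))).trace * hy
  exact_mod_cast mul_right_cancel₀ htr h3

end Instrument

/-! ### Learnability of the correlations -/

section Learnability

variable {m n : ℕ} {ι : Type*} {G : CliffordGate (Qubits m n)}
  {gates : ι → CliffordGate (Qubits m n)}

theorem CliffordGate.exists_sign_pull {κ : Type*} [Fintype κ] [DecidableEq κ]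
    (G : CliffordGate κ) (P : Pauli κ) :
    ∃ ε : ℝ, ε ≠ 0 ∧ G.matᴴ * pauliMat P * G.mat = (ε : ℂ) • pauliMat (G.pull P) := by
  rcases (G.isClifford.2 P).choose_spec with h | h
  · exact ⟨1, one_ne_zero, by rw [h, CliffordGate.pull, Complex.ofReal_one, one_smul]⟩
  · exact ⟨-1, by norm_num, by rw [h, CliffordGate.pull]; simp⟩

theorem NoiseModel.prob_pauliPOVM_sub (N : NoiseModel G gates) (steps : List (Step m n ι))
    (P : Pauli (Qubits m n)) (ks : List (Bits (Fin n))) :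
    N.prob steps (pauliPOVM P) ks 0 - N.prob steps (pauliPOVM P) ks 1 =
      pauliFidelity N.measNoise.rate P * (pauliMat P * N.run steps ks N.state).trace.re := by
  rw [prob, prob, ← Complex.sub_re, ← Matrix.trace_sub, ← Matrix.sub_mul, pauliPOVM_effect_sub,
    trace_pauliMat_mul_pauliChannel, Complex.re_ofReal_mul]

/-- A layer of single-qubit gates followed by one mid-circuit measurement, evaluated with the
signs `(-1)^((x+y)·k)`, gives the fidelity `λ_{x,y}^Q` up to a factor for the preparation
and a factor for the terminating measurement. -/
theorem exists_experiment (G : CliffordGate (Qubits m n)) (x : Bits (Fin n)) (Q : Pauli (Fin m))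
    {P : Pauli (Qubits m n)} (hP : pt P = pt (G.pull (withZ Q x))) :
    ∃ (U : Qubits m n → Matrix.unitaryGroup (ZMod 2) ℂ) (ε : ℝ), ε ≠ 0 ∧
      ∀ (ι : Type*) (gates : ι → CliffordGate (Qubits m n)) (N : NoiseModel G gates)
        (y : Bits (Fin n)),
        ∑ k, sgn ((x + y) ⬝ᵥ k) *
            (N.prob [.single U, .mcm] (pauliPOVM (withZ Q y)) [k] 0 -
              N.prob [.single U, .mcm] (pauliPOVM (withZ Q y)) [k] 1) =
          ε * (pauliMat P * N.state).trace.re * N.fid x y Q *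
            pauliFidelity N.measNoise.rate (withZ Q y) := by
  obtain ⟨U, hU⟩ := exists_single_conj_pauliMat hP
  obtain ⟨ε, hε, hG⟩ := G.exists_sign_pull (withZ Q x)
  -- `U` and `ε` are fixed before the noise model and `y`, so two models can be compared on the same
  -- experiment.
  refine ⟨U, ε, hε, fun ι gates N y => ?_⟩
  have h := congrArg Complex.re (sum_sgn_trace_instrument N.mcm.rate x y Q
    (conjBy G.mat (conjBy (localOp fun q => (U q : Matrix (ZMod 2) (ZMod 2) ℂ)) N.state)))
  rw [trace_mul_conjBy, hG, Matrix.smul_mul, Matrix.trace_smul, trace_mul_conjBy, hU,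
    Complex.re_ofReal_mul, smul_eq_mul, Complex.re_ofReal_mul, Complex.re_sum] at h
  simp only [Complex.re_ofReal_mul] at h
  simp only [NoiseModel.prob_pauliPOVM_sub, NoiseModel.run]
  rw [NoiseModel.fid, mul_comm (ε * _), ← h, Finset.sum_mul]
  exact Finset.sum_congr rfl fun k _ => by ring

/-- The fidelities of indistinguishable noise models agree up to gauge factors for the
preparation and for the terminating measurement. -/
theorem Indistinguishable.exists_gauge {N₁ N₂ : NoiseModel G gates}
    (h : Indistinguishable N₁ N₂) (Q : Pauli (Fin m)) :
    ∃ α β : Bits (Fin n) → ℝ, ∀ x y,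
      Real.log (N₁.fid x y Q) = Real.log (N₂.fid x y Q) + α x + β y := by
  choose P hP hP0 using fun x => N₁.state_overlap x Q
  choose U ε hε hexp using fun x => exists_experiment G x Q (hP x)
  set A₁ : Bits (Fin n) → ℝ := fun x => (pauliMat (P x) * N₁.state).trace.re with hA₁
  set A₂ : Bits (Fin n) → ℝ := fun x => (pauliMat (P x) * N₂.state).trace.re with hA₂
  set B₁ : Bits (Fin n) → ℝ := fun y => pauliFidelity N₁.measNoise.rate (withZ Q y) with hB₁
  set B₂ : Bits (Fin n) → ℝ := fun y => pauliFidelity N₂.measNoise.rate (withZ Q y) with hB₂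
  have hB₁0 : ∀ y, B₁ y ≠ 0 := fun y => (N₁.measNoise.fidelity_pos _).ne'
  have hB₂0 : ∀ y, B₂ y ≠ 0 := fun y => (N₂.measNoise.fidelity_pos _).ne'
  have hN₁ : ∀ x y, N₁.fid x y Q ≠ 0 := fun x y => (N₁.mcm.fidelity_pos x y Q).ne'
  have hN₂ : ∀ x y, N₂.fid x y Q ≠ 0 := fun x y => (N₂.mcm.fidelity_pos x y Q).ne'
  -- `P` has nonzero trace against the state of `N₁`, and this trace is real because the state is
  -- Hermitian.
  have hA₁0 : ∀ x, A₁ x ≠ 0 := fun x h0 =>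
    hP0 x (Complex.ext h0 (trace_pauliMat_mul_im N₁.state_posSemidef.isHermitian))
  have key : ∀ x y, A₁ x * N₁.fid x y Q * B₁ y = A₂ x * N₂.fid x y Q * B₂ y := fun x y => by
    have h1 := hexp x ι gates N₁ y
    have h2 := hexp x ι gates N₂ y
    simp only [fun F k j => h [.single (U x), .mcm] 2 F [k] j] at h1
    rw [h2] at h1
    apply mul_left_cancel₀ (hε x)
    linear_combination -h1
  -- `P` was chosen for `N₁` only; its overlap with the state of `N₂` is nonzero because the two
  -- experiments agree.
  have hA₂0 : ∀ x, A₂ x ≠ 0 := fun x h0 => by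
    have := key x 0
    rw [h0, zero_mul, zero_mul] at this
    exact mul_ne_zero (mul_ne_zero (hA₁0 x) (hN₁ x 0)) (hB₁0 0) this
  refine ⟨fun x => Real.log (A₂ x) - Real.log (A₁ x), fun y => Real.log (B₂ y) - Real.log (B₁ y),
    fun x y => ?_⟩
  -- `A₁` and `A₂` may be negative: `Real.log` is $\log|\cdot|$, additive on products of nonzero
  -- reals.
  have hlog := congrArg Real.log (key x y)
  rw [Real.log_mul (mul_ne_zero (hA₁0 x) (hN₁ x y)) (hB₁0 y), Real.log_mul (hA₁0 x) (hN₁ x y),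
    Real.log_mul (mul_ne_zero (hA₂0 x) (hN₂ x y)) (hB₂0 y), Real.log_mul (hA₂0 x) (hN₂ x y)]
    at hlog
  linear_combination hlog

theorem learnable_correlation (x₁ x₂ y₁ y₂ : Bits (Fin n)) (Q : Pauli (Fin m)) :
    Learnable fun N : NoiseModel G gates => N.correlation x₁ x₂ y₁ y₂ Q := fun N₁ N₂ h => by
  obtain ⟨α, β, hαβ⟩ := h.exists_gauge Q
  simp only [NoiseModel.correlation, hαβ]
  ring

theorem NoiseModel.fidelitiesFactorize_iff (N : NoiseModel G gates) :
    N.FidelitiesFactorize ↔ ∀ x₁ x₂ y₁ y₂ Q, N.correlation x₁ x₂ y₁ y₂ Q = 0 := by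
  have hpos : ∀ x y Q, 0 < N.fid x y Q := N.mcm.fidelity_pos
  constructor
  · rintro ⟨ζ, ξ, h⟩ x₁ x₂ y₁ y₂ Q
    -- `ζ` and `ξ` are nonzero since their product is positive, but either may be negative;
    -- `Real.log` ignores the sign.
    have hlog : ∀ x y, Real.log (N.fid x y Q) = Real.log (ζ x Q) + Real.log (ξ y Q) :=
      fun x y => by
        have h0 := (hpos x y Q).ne'
        rw [h] at h0 ⊢
        exact Real.log_mul (left_ne_zero_of_mul h0) (right_ne_zero_of_mul h0)
    simp only [correlation, hlog]
    ring
  · intro h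
    -- The rectangle with corners $(x,y)$ and $(0,0)$ gives
    -- $\lambda_{x,y}\lambda_{0,0}=\lambda_{x,0}\lambda_{0,y}$, hence these factors.
    refine ⟨fun x Q => N.fid x 0 Q, fun y Q => N.fid 0 y Q / N.fid 0 0 Q, fun x y Q => ?_⟩
    have hxy := (hpos x y Q).ne'
    have hx := (hpos x 0 Q).ne'
    have hy := (hpos 0 y Q).ne'
    have h0 := (hpos 0 0 Q).ne'
    have hc := h x 0 y 0 Q
    rw [correlation] at hc
    apply Real.log_injOn_pos (hpos x y Q)
      (mul_pos (hpos x 0 Q) (div_pos (hpos 0 y Q) (hpos 0 0 Q)))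
    rw [Real.log_mul hx (div_ne_zero hy h0), Real.log_div hy h0]
    linear_combination hc

/-! ### Cycles of the pattern transfer graph -/

/-- The source of an edge depends only on $(Q,x)$ and its target only on $(Q,y)$, so every endpoint
occurs once with each sign. -/
theorem correlationChain_mem_cycleSpace (G : CliffordGate (Qubits m n))
    (x₁ x₂ y₁ y₂ : Bits (Fin n)) (Q : Pauli (Fin m)) :
    correlationChain x₁ x₂ y₁ y₂ Q ∈ cycleSpace G := by
  rw [cycleSpace, LinearMap.mem_ker, boundary, correlationChain]
  simp only [map_sub, map_add, Finsupp.linearCombination_single, one_smul, Edge.src, Edge.tgt]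
  abel

theorem chainValue_correlationChain (x₁ x₂ y₁ y₂ : Bits (Fin n)) (Q : Pauli (Fin m))
    (N : NoiseModel G gates) :
    chainValue (correlationChain x₁ x₂ y₁ y₂ Q) N = N.correlation x₁ x₂ y₁ y₂ Q := by
  change Finsupp.linearCombination ℝ (fun e : Edge m n => Real.log (N.fid e.x e.y e.Q))
    (correlationChain x₁ x₂ y₁ y₂ Q) = _
  simp only [correlationChain, map_sub, map_add, Finsupp.linearCombination_single, one_smul,
    NoiseModel.correlation]

end Learnability

end MCM

theorem mainTheorem8 {ι : Type*} (m n : ℕ) (G : MCM.CliffordGate (MCM.Qubits m n))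
    (gates : ι → MCM.CliffordGate (MCM.Qubits m n)) :
    -- each correlation is a cycle of the pattern transfer graph, and is learnable
    (∀ (x₁ x₂ y₁ y₂ : MCM.Bits (Fin n)) (Q : MCM.Pauli (Fin m)),
      MCM.correlationChain x₁ x₂ y₁ y₂ Q ∈ MCM.cycleSpace G ∧
      (∀ N : MCM.NoiseModel G gates,
        MCM.chainValue (MCM.correlationChain x₁ x₂ y₁ y₂ Q) N = N.correlation x₁ x₂ y₁ y₂ Q) ∧
      MCM.Learnable fun N : MCM.NoiseModel G gates => N.correlation x₁ x₂ y₁ y₂ Q) ∧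
    -- hence the test for the measure-and-prepare structure is robust against SPAM noise
    (∀ N : MCM.NoiseModel G gates,
      (MCM.IsMeasureAndPrepare N.mcm.rate → N.FidelitiesFactorize) ∧
      (N.FidelitiesFactorize ↔ ∀ x₁ x₂ y₁ y₂ Q, N.correlation x₁ x₂ y₁ y₂ Q = 0)) ∧
    (∀ N₁ N₂ : MCM.NoiseModel G gates, MCM.Indistinguishable N₁ N₂ →
      (N₁.FidelitiesFactorize ↔ N₂.FidelitiesFactorize)) :=
  ⟨fun x₁ x₂ y₁ y₂ Q => ⟨MCM.correlationChain_mem_cycleSpace G x₁ x₂ y₁ y₂ Q,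
      MCM.chainValue_correlationChain x₁ x₂ y₁ y₂ Q, MCM.learnable_correlation x₁ x₂ y₁ y₂ Q⟩,
    fun N => ⟨fun h => h.exists_factorization, N.fidelitiesFactorize_iff⟩,
    fun N₁ N₂ h => by
      -- Factorization is a condition on the correlations alone, and these agree on
      -- indistinguishable models.
      rw [N₁.fidelitiesFactorize_iff, N₂.fidelitiesFactorize_iff]
      simp only [fun x₁ x₂ y₁ y₂ Q => MCM.learnable_correlation x₁ x₂ y₁ y₂ Q N₁ N₂ h]⟩
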